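/- Let $\mathcal K$ be a finite set of nodes of a network with graph $G$. Node $k$ senses a signal $\boldsymbol y_k$ with $M_k$ channels, $\boldsymbol y$ is the stacking of the $\boldsymbol y_k$, $M=\sum_k M_k$, and $X\in\mathbb R^{M\times Q}$ has blocks $X_k\in\mathbb R^{M_k\times Q}$. Consider the global problem $$\min_{X\in\mathbb R^{M\times Q}} L(X)=f(X)+g(X)\quad\text{s.t. } X\in\mathcal X,\qquad f(X)=\varphi(X^T\boldsymbol y,X^TB),\quad g(X)=\gamma(X^TA),$$ where $\mathcal X$ is the set of all $X$ such that, for every $k$, $\eta_j(X_k^T\boldsymbol y_k,X_k^TD_{j,k})\le 0$ for $j\in\mathcal J_I^k$ and $\eta_j(X_k^T\boldsymbol y_k,X_k^TD_{j,k})=0$ for $j\in\mathcal J_E^k$. Here $\varphi$ and the $\eta_j$ are smooth (it is enough that $f$ and the maps $X_k\mapsto\eta_j(X_k^T\boldsymbol y_k,X_k^TD_{j,k})$ are $C^1$), $\gamma$ is real-valued and convex, $A$ is block diagonal with blocks $A_k$, and $\gamma(X^TA)=\sum_k\gamma_k(X_k^TA_k)$ for some functions $\gamma_k$. For every node $q$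 let $\mathcal T_q$ be a spanning tree of $G$, rooted at $q$, and let $\mathcal N_q$ be the set of neighbors of $q$ in it; for $n\in\mathcal N_q$ the branch $\mathcal B_{nq}$ is the set of nodes of the component of $n$ once the link between $q$ and $n$ is removed from $\mathcal T_q$. Let $C_q(X)$ be the matrix with $C_q(X)^T\boldsymbol y=[\boldsymbol y_q;\,X_k^T\boldsymbol y_k,\ k\ne q]$, and let $T_q=\mathrm{blkdiag}(I_{M_q},N\otimes I_Q)$, where $N$ has rows indexed by $n\in\mathcal N_q$, columns indexed by $k\neq q$, and $N_{n,k}=1$ if $k\in\mathcal B_{nq}$, $N_{n,k}=0$ otherwise. Let $\mathcal S'_q(X)\subseteq\mathbb R^{M\times Q}$ be the set of matrices whose columns all lie in the column space of $C_q(X)T_q^T$, and $$F_q(X)=\operatorname*{argmin}_{U\in\mathcal X\cap\mathcal S'_q(X)}L(U).$$ Let $X^\circ$ be a fixed point, i.e. $X^\circ\in F_k(X^\circ)$ for every $k\in\mathcal K$, that satisfies for every $k\in\mathcal K$ the qualification $$\forall U\in N_{\mathcal X}(X^\circ),\quad T_kC_k(X^\circ)^TU=0\ \Rightarrow\ U=0,$$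 where $N_{\mathcal X}(X^\circ)$ is the (limiting) normal cone to $\mathcal X$ at $X^\circ$. Then $X^\circ$ is a stationary point of the global problem: $$0\in\nabla f(X^\circ)+\partial g(X^\circ)+N_{\mathcal X}(X^\circ).$$ -/

import Mathlib

open Filter Topology
open scoped Matrix Kronecker Pointwise Matrix.Norms.Frobenius

noncomputable section

/-! ### Matrix spaces as Euclidean spaces

Matrices carry the Frobenius norm (from `Matrix.Norms.Frobenius`) and the trace inner product
`⟨A, B⟩ = tr (Aᵀ B)`, which induces that norm. -/

instance Matrix.frobeniusInnerProductSpace {m n : Type*} [Fintype m] [Fintype n] :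
    InnerProductSpace ℝ (Matrix m n ℝ) where
  inner A B := Matrix.trace (Aᵀ * B)
  norm_sq_eq_re_inner A := by
    have h0 : (0 : ℝ) ≤ ∑ i, ∑ j, ‖A i j‖ ^ (2 : ℝ) :=
      Finset.sum_nonneg fun i _ => Finset.sum_nonneg fun j _ => by positivity
    rw [Matrix.frobenius_norm_def, ← Real.rpow_natCast, ← Real.rpow_mul h0]
    simp only [Matrix.trace, Matrix.diag_apply, Matrix.mul_apply, Matrix.transpose_apply]
    norm_num
    rw [Finset.sum_comm]
    simp [sq]
  conj_inner_symm A B := by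
    simp only [conj_trivial]
    rw [← Matrix.trace_transpose, Matrix.transpose_mul, Matrix.transpose_transpose]
  add_left A B C := by
    rw [Matrix.transpose_add, Matrix.add_mul, Matrix.trace_add]
  smul_left A B r := by
    simp

instance Matrix.frobeniusCompleteSpace {m n : Type*} [Fintype m] [Fintype n] :
    CompleteSpace (Matrix m n ℝ) :=
  FiniteDimensional.complete ℝ _

namespace NSDASF

/-! ### Variational analysis -/

section VariationalAnalysis

variable {E : Type*} [NormedAddCommGroup E] [InnerProductSpace ℝ E]

/-- Regular (Fréchet) normal vectors to `C` at `x`: `⟨v, z - x⟩ ≤ o(‖z - x‖)` for `z ∈ C`, `z → x`.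
There are none at points outside `C`. -/
def regularNormalCone (C : Set E) (x : E) : Set E :=
  {v | x ∈ C ∧ ∀ ε : ℝ, 0 < ε → ∀ᶠ z in 𝓝[C] x, inner ℝ v (z - x) ≤ ε * ‖z - x‖}

/-- The (general, limiting) normal cone `N_C(x)`: limits of regular normals at points
of `C` converging to `x`. It is empty at points outside `C`. -/
def normalCone (C : Set E) (x : E) : Set E :=
  {v | x ∈ C ∧ ∃ (xs vs : ℕ → E), (∀ i, vs i ∈ regularNormalCone C (xs i)) ∧
    Tendsto xs atTop (𝓝 x) ∧ Tendsto vs atTop (𝓝 v)}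

/-- The subdifferential of a convex function: slopes of its affine minorants that are exact
at `x`. -/
def subdifferential (g : E → ℝ) (x : E) : Set E :=
  {v | ∀ z, g x + inner ℝ v (z - x) ≤ g z}

/-- The set of minimizers of `L` over `C`. -/
def argmin (L : E → ℝ) (C : Set E) : Set E :=
  {u | u ∈ C ∧ ∀ z ∈ C, L u ≤ L z}

end VariationalAnalysis

/-! ### The optimization problem -/

/-- Filter output `Xᵀ y`, for a signal `y` whose channels lie in a real vector space `H` of
scalar signals (for example random variables, square integrable random variables, or vectors of
samples). -/
def filterOutput {m n H : Type*} [Fintype m] [AddCommGroup H] [Module ℝ H]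
    (X : Matrix m n ℝ) (y : m → H) : n → H :=
  fun j => ∑ i, X i j • y i

/-- The data of the filtering problem
`min φ(Xᵀy, XᵀB) + γ(XᵀA)` subject to `η_j(X_kᵀy_k, X_kᵀD_{j,k}) ≤ 0` for `j ∈ JI k` and
`η_j(X_kᵀy_k, X_kᵀD_{j,k}) = 0` for `j ∈ JE k`, for all nodes `k : ι`. -/
structure Problem (ι : Type*) (H : Type*) where
  /-- number of filter outputs -/
  Q : ℕ
  /-- number of channels of each node -/
  M : ι → ℕ
  /-- number of columns of `B` -/
  b : ℕ
  /-- number of columns of the diagonal blocks of `A` -/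
  a : ι → ℕ
  /-- constraint labels -/
  J : Type*
  /-- number of columns of `D j k` -/
  d : J → ℕ
  /-- `y k` is the signal sensed by node `k` -/
  y : ∀ k, Fin (M k) → H
  B : Matrix (Σ k, Fin (M k)) (Fin b) ℝ
  /-- diagonal blocks of the block diagonal matrix `A` -/
  A : ∀ k, Matrix (Fin (M k)) (Fin (a k)) ℝ
  D : ∀ (j : J) (k : ι), Matrix (Fin (M k)) (Fin (d j)) ℝ
  φ : (Fin Q → H) → Matrix (Fin Q) (Fin b) ℝ → ℝ
  γ : Matrix (Fin Q) (Σ k, Fin (a k)) ℝ → ℝ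
  η : ∀ j : J, (Fin Q → H) → Matrix (Fin Q) (Fin (d j)) ℝ → ℝ
  /-- inequality constraints of each node -/
  JI : ι → Set J
  /-- equality constraints of each node -/
  JE : ι → Set J

namespace Problem

variable {ι : Type*} [Fintype ι] [DecidableEq ι] {H : Type*} [AddCommGroup H] [Module ℝ H]
variable (P : Problem ι H)

/-- Index set of the channels of the whole network; it has `∑ k, M k` elements. -/
abbrev Chan : Type _ := Σ k, Fin (P.M k)

/-- The network-wide signal, the stacking of all `y k`. -/
def signal : P.Chan → H := fun c => P.y c.1 c.2

/-- The `k`-th block `X_k` of `X`. -/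
def block (X : Matrix P.Chan (Fin P.Q) ℝ) (k : ι) : Matrix (Fin (P.M k)) (Fin P.Q) ℝ :=
  fun m j => X ⟨k, m⟩ j

/-- `f(X) = φ(Xᵀy, XᵀB)`. -/
def f (X : Matrix P.Chan (Fin P.Q) ℝ) : ℝ :=
  P.φ (filterOutput X P.signal) (Xᵀ * P.B)

/-- `g(X) = γ(XᵀA)`, where `A` is block diagonal. -/
def g (X : Matrix P.Chan (Fin P.Q) ℝ) : ℝ :=
  P.γ (Xᵀ * Matrix.blockDiagonal' P.A)

/-- The objective function. -/
def L (X : Matrix P.Chan (Fin P.Q) ℝ) : ℝ := P.f X + P.g X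

/-- The constraint function of node `k` and label `j`: `x ↦ η_j(xᵀy_k, xᵀD_{j,k})`. -/
def constr (k : ι) (j : P.J) (x : Matrix (Fin (P.M k)) (Fin P.Q) ℝ) : ℝ :=
  P.η j (filterOutput x (P.y k)) (xᵀ * P.D j k)

/-- The feasible set. -/
def feasibleSet : Set (Matrix P.Chan (Fin P.Q) ℝ) :=
  {X | ∀ k, (∀ j ∈ P.JI k, P.constr k j (P.block X k) ≤ 0) ∧
    (∀ j ∈ P.JE k, P.constr k j (P.block X k) = 0)}

/-- The standing assumptions on the problem. Smoothness (only `C¹` is required) of `φ` and of the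
`η j` is asked of their dependence on the filter coefficients; the filter outputs
depend linearly on these. -/
structure Standing : Prop where
  smooth_φ : ContDiff ℝ 1 P.f
  smooth_η : ∀ k, ∀ j ∈ P.JI k ∪ P.JE k, ContDiff ℝ 1 (P.constr k j)
  convex_γ : ConvexOn ℝ Set.univ P.γ
  separable_γ : ∃ γ' : ∀ k, Matrix (Fin P.Q) (Fin (P.a k)) ℝ → ℝ,
    ∀ X : Matrix P.Chan (Fin P.Q) ℝ,
      P.γ (Xᵀ * Matrix.blockDiagonal' P.A) = ∑ k, γ' k ((P.block X k)ᵀ * P.A k)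

/-- Stationary points: `0 ∈ ∇f(X) + ∂g(X) + N(X)`, with `N` the normal cone of the feasible set. -/
def IsStationary (X : Matrix P.Chan (Fin P.Q) ℝ) : Prop :=
  0 ∈ {gradient P.f X} + subdifferential P.g X + normalCone P.feasibleSet X

/-! ### In-network fusion -/

/-- The compression matrix `C_q(X)`: it satisfies
`C_q(X)ᵀ y = [y_q; X_kᵀ y_k, k ≠ q]`. -/
def C (q : ι) (X : Matrix P.Chan (Fin P.Q) ℝ) :
    Matrix P.Chan (Fin (P.M q) ⊕ {k // k ≠ q} × Fin P.Q) ℝ :=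
  fun c s => match s with
    | .inl m => if c = ⟨q, m⟩ then 1 else 0
    | .inr (k, j) => if c.1 = k.1 then X c j else 0

end Problem

/-- The branch of the tree `T` that contains the node `n` once the link between `q` and `n` is
removed. -/
def branch {ι : Type*} (T : SimpleGraph ι) (q n : ι) : Set ι :=
  {l | (T.deleteEdges {s(q, n)}).Reachable n l}

open Classical in
/-- The `0`-`1` matrix `N` of the tree `T` rooted at `q`: its rows are the neighbors of `q` in the
tree, its columns the nodes other than `q`, and an entry is `1` when the column's node is in
the row's branch. -/
def aggregation {ι : Type*} (T : SimpleGraph ι) (q : ι) :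
    Matrix {n // T.Adj q n} {k // k ≠ q} ℝ :=
  fun n k => if k.1 ∈ branch T q n.1 then 1 else 0

namespace Problem

variable {ι : Type*} [Fintype ι] [DecidableEq ι] {H : Type*} [AddCommGroup H] [Module ℝ H]
variable (P : Problem ι H)

/-- The fusion matrix `T_q = blkdiag(I, N ⊗ I)` of the tree `T` rooted at `q`. -/
def fusion (T : SimpleGraph ι) (q : ι) :
    Matrix (Fin (P.M q) ⊕ {n // T.Adj q n} × Fin P.Q) (Fin (P.M q) ⊕ {k // k ≠ q} × Fin P.Q) ℝ :=
  Matrix.fromBlocks 1 0 0 (aggregation T q ⊗ₖ (1 : Matrix (Fin P.Q) (Fin P.Q) ℝ))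

open Classical in
/-- `S'_q(X)`: the matrices whose columns all lie in the column space of `C_q(X) T_qᵀ`. -/
def localRange (T : SimpleGraph ι) (q : ι) (X : Matrix P.Chan (Fin P.Q) ℝ) :
    Set (Matrix P.Chan (Fin P.Q) ℝ) :=
  {U | ∃ W : Matrix (Fin (P.M q) ⊕ {n // T.Adj q n} × Fin P.Q) (Fin P.Q) ℝ,
    U = P.C q X * (P.fusion T q)ᵀ * W}

/-- The update map `F_q` of the distributed algorithm, when the data is fused along the tree `T`
rooted at the updating node `q`. -/
def updateMap (T : SimpleGraph ι) (q : ι) (X : Matrix P.Chan (Fin P.Q) ℝ) :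
    Set (Matrix P.Chan (Fin P.Q) ℝ) :=
  argmin P.L (P.feasibleSet ∩ P.localRange T q X)

/-- Fixed points of the algorithm: `X ∈ F_k(X)` for every node `k`, where `T k` is the tree used
when `k` is the updating node. -/
def IsFixedPoint (T : ι → SimpleGraph ι) (X : Matrix P.Chan (Fin P.Q) ℝ) : Prop :=
  ∀ k, X ∈ P.updateMap (T k) k X

end Problem

end NSDASF

end

/-! Fix a node `q`. A fixed point minimizes `f + g` over the feasible set intersected with a
subspace `K_q`, the range of `C_q T_qᵀ` acting columnwise. The qualification says that no nonzero
normal lies in `K_qᗮ`, so the multiplier rule `exists_add_mem_orthogonal_of_mem_argmin` gives a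
subgradient `v_q` and a normal `n_q` at `X` with `∇f(X) + v_q + n_q ∈ K_qᗮ`. Since `C_q` and `T_q`
act as the identity on the channels of `q`, block `q` of this sum vanishes.

The pairs `(v_q, n_q)` may differ from node to node. The feasible set is however a product over the
nodes and `g` is a sum over the nodes, so the matrix whose block `q` is that of `v_q` is again a
subgradient, and likewise for the normals (`sum_mem_subdifferential`, `sum_mem_normalCone`). For
these glued multipliers every block of `∇f + v + n` is zero. -/

namespace NSDASF

/-! ### Subgradients, normals and a multiplier rule by penalization -/

section Calculus

variable {E : Type*} [NormedAddCommGroup E] [InnerProductSpace ℝ E]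

/-- Fermat's rule for a differentiable function on a set. -/
theorem neg_mem_regularNormalCone [CompleteSpace E] {h : E → ℝ} {G x : E} {C : Set E}
    (hG : HasGradientAt h G x) (hx : x ∈ C) (hmin : ∀ᶠ z in 𝓝[C] x, h x ≤ h z) :
    -G ∈ regularNormalCone C x := by
  refine ⟨hx, fun ε hε => ?_⟩
  have h1 := (hasGradientAt_iff_isLittleO.1 hG).def hε
  filter_upwards [hmin, nhdsWithin_le_nhds h1] with z hz h2
  have := neg_abs_le (h z - h x - inner ℝ G (z - x))
  rw [Real.norm_eq_abs] at h2
  have h3 := le_abs_self (h z - h x - inner ℝ G (z - x))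
  rw [inner_neg_left]
  linarith

theorem smul_mem_regularNormalCone {C : Set E} {x v : E} {t : ℝ} (ht : 0 < t)
    (hv : v ∈ regularNormalCone C x) : t • v ∈ regularNormalCone C x := by
  refine ⟨hv.1, fun ε hε => ?_⟩
  filter_upwards [hv.2 (ε / t) (by positivity)] with z hz
  rw [real_inner_smul_left]
  calc t * inner ℝ v (z - x) ≤ t * (ε / t * ‖z - x‖) := by gcongr
    _ = ε * ‖z - x‖ := by field_simp

theorem smul_mem_normalCone {C : Set E} {x v : E} {t : ℝ} (ht : 0 < t)
    (hv : v ∈ normalCone C x) : t • v ∈ normalCone C x := by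
  obtain ⟨hx, xs, vs, h, hxs, hvs⟩ := hv
  exact ⟨hx, xs, fun i => t • vs i, fun i => smul_mem_regularNormalCone ht (h i), hxs,
    hvs.const_smul t⟩

/-- A point that minimizes locally the sum of a convex function and a squared distance yields a
subgradient of the convex function. -/
theorem smul_sub_mem_subdifferential {g : E → ℝ} (hg : ConvexOn ℝ Set.univ g) {z u : E} {c : ℝ}
    (hmin : ∀ᶠ w in 𝓝 u, g u + c / 2 * ‖z - u‖ ^ 2 ≤ g w + c / 2 * ‖z - w‖ ^ 2) :
    c • (z - u) ∈ subdifferential g u := by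
  intro w
  have hlim : Tendsto (fun s : ℝ => u + s • (w - u)) (𝓝[>] 0) (𝓝 u) := by
    have : Continuous fun s : ℝ => u + s • (w - u) := by fun_prop
    simpa using (this.tendsto 0).mono_left nhdsWithin_le_nhds
  -- Compare `u` with `u + s • (w - u)`, bound `g` there by convexity and divide by `s`; the
  -- remaining quadratic term is of order `s`.
  have h1 : ∀ᶠ s : ℝ in 𝓝[>] 0,
      g u + c * inner ℝ (z - u) (w - u) - c / 2 * s * ‖w - u‖ ^ 2 ≤ g w := by
    filter_upwards [hlim.eventually hmin, Ioo_mem_nhdsGT (zero_lt_one' ℝ)] with s hs hs1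
    have hconv := hg.2 (Set.mem_univ u) (Set.mem_univ w) (sub_nonneg.2 hs1.2.le) hs1.1.le
      (by ring)
    rw [show (1 - s) • u + s • w = u + s • (w - u) by module] at hconv
    have hn : ‖z - (u + s • (w - u))‖ ^ 2
        = ‖z - u‖ ^ 2 - 2 * (s * inner ℝ (z - u) (w - u)) + s ^ 2 * ‖w - u‖ ^ 2 := by
      rw [show z - (u + s • (w - u)) = (z - u) - s • (w - u) by abel, norm_sub_sq_real,
        real_inner_smul_right, norm_smul, mul_pow, Real.norm_eq_abs, sq_abs]
    rw [hn] at hs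
    simp only [smul_eq_mul] at hconv
    refine le_of_mul_le_mul_left ?_ hs1.1
    nlinarith
  have h2 : Tendsto (fun s : ℝ => g u + c * inner ℝ (z - u) (w - u) - c / 2 * s * ‖w - u‖ ^ 2)
      (𝓝[>] 0) (𝓝 (g u + c * inner ℝ (z - u) (w - u))) := by
    have : Continuous fun s : ℝ =>
      g u + c * inner ℝ (z - u) (w - u) - c / 2 * s * ‖w - u‖ ^ 2 := by fun_prop
    simpa using (this.tendsto 0).mono_left nhdsWithin_le_nhds
  rw [real_inner_smul_left]
  exact le_of_tendsto h2 h1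

/-- The subdifferential of a continuous function has a closed graph. -/
theorem mem_subdifferential_of_tendsto {g : E → ℝ} (hg : Continuous g) {us vs : ℕ → E} {u v : E}
    (hus : Tendsto us atTop (𝓝 u)) (hvs : Tendsto vs atTop (𝓝 v))
    (h : ∀ᶠ i in atTop, vs i ∈ subdifferential g (us i)) : v ∈ subdifferential g u := by
  intro z
  refine le_of_tendsto (((hg.tendsto u).comp hus).add
    (hvs.inner (tendsto_const_nhds.sub hus))) ?_
  filter_upwards [h] with i hi using hi z

/-- A unit step from `u` in the direction of `v` raises `g` by at least `‖v‖`, while `g` varies by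
at most `2 * R` on the larger ball. -/
theorem norm_le_of_mem_subdifferential {g : E → ℝ} {x u v : E} {r R : ℝ}
    (hR : ∀ w ∈ Metric.closedBall x (r + 1), |g w| ≤ R) (hu : u ∈ Metric.closedBall x r)
    (hv : v ∈ subdifferential g u) : ‖v‖ ≤ 2 * R := by
  have hu' := Metric.closedBall_subset_closedBall (by linarith : r ≤ r + 1) hu
  rcases eq_or_ne v 0 with rfl | hv0
  · have := (abs_nonneg _).trans (hR u hu')
    simpa using this
  have hpos : 0 < ‖v‖ := norm_pos_iff.2 hv0
  have hw : u + ‖v‖⁻¹ • v ∈ Metric.closedBall x (r + 1) := by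
    rw [mem_closedBall_iff_norm] at hu ⊢
    calc ‖u + ‖v‖⁻¹ • v - x‖ = ‖(u - x) + ‖v‖⁻¹ • v‖ := by congr 1; abel
      _ ≤ ‖u - x‖ + ‖‖v‖⁻¹ • v‖ := norm_add_le _ _
      _ ≤ r + 1 := by
        rw [norm_smul, norm_inv, norm_norm, inv_mul_cancel₀ hpos.ne']
        linarith
  have h1 := hv (u + ‖v‖⁻¹ • v)
  rw [add_sub_cancel_left, real_inner_smul_right, real_inner_self_eq_norm_sq, sq,
    inv_mul_cancel_left₀ hpos.ne'] at h1
  have h2 := abs_le.1 (hR _ hw)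
  have h3 := abs_le.1 (hR _ hu')
  linarith [h2.2, h3.1]

/-- Optimality condition for the minimization of the sum of a `C¹` function and a convex function
over the intersection of a closed set and a subspace. -/
theorem exists_add_mem_orthogonal_of_mem_argmin [FiniteDimensional ℝ E] [CompleteSpace E]
    {f g : E → ℝ} (hf : ContDiff ℝ 1 f) (hg : ConvexOn ℝ Set.univ g) {C : Set E}
    (hC : IsClosed C) (K : Submodule ℝ E) {x : E}
    (hx : x ∈ argmin (fun z => f z + g z) (C ∩ K))
    (hq : ∀ n ∈ normalCone C x, n ∈ Kᗮ → n = 0) :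
    ∃ v ∈ subdifferential g x, ∃ n ∈ normalCone C x, gradient f x + v + n ∈ Kᗮ := by
  obtain ⟨⟨hxC, hxK⟩, hmin⟩ := hx
  have hgc : Continuous g := by
    rw [← continuousOn_univ]
    exact hg.continuousOn isOpen_univ
  have hfc : Continuous f := hf.continuous
  -- As `x ∈ K`, membership of `z` in `K` amounts to `p (z - x) = 0`, which can be penalized.
  let p : E →L[ℝ] E := Kᗮ.starProjection
  have hpK : ∀ z, p z ∈ Kᗮ := fun z => Kᗮ.starProjection_apply_mem z
  have hpinner : ∀ y z, inner ℝ (p y) (p z) = inner ℝ (p y) z := by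
    intro y z
    have h1 : z - p z ∈ Kᗮᗮ := Kᗮ.sub_starProjection_mem_orthogonal z
    have h2 := (Submodule.mem_orthogonal _ _).1 h1 (p y) (hpK y)
    rw [inner_sub_right] at h2
    linarith
  have hp0 : ∀ z, p z = 0 → z ∈ K := by
    intro z hz
    have h1 : z - p z ∈ Kᗮᗮ := Kᗮ.sub_starProjection_mem_orthogonal z
    rwa [hz, sub_zero, Submodule.orthogonal_orthogonal] at h1
  -- Splitting the variable separates the subgradient of `g` from the normal to `C`. The weights `k
  -- / 2` enforce in the limit that the copies agree and lie in `K`; the last term singles out `x`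
  -- among the minimizers.
  let Φ : ℕ → E × E → ℝ := fun k w => f w.1 + g w.2 + (k : ℝ) / 2 * ‖w.1 - w.2‖ ^ 2
    + (k : ℝ) / 2 * ‖p (w.1 - x)‖ ^ 2 + 1 / 2 * ‖w.1 - x‖ ^ 2
  have hΦc : ∀ k, Continuous (Φ k) := by intro k; fun_prop
  -- The ball provides compactness; it becomes inactive once the minimizers are close to its center.
  let B := Metric.closedBall x 1
  have hB : IsCompact B := isCompact_closedBall x 1
  have hcomp : IsCompact ((C ∩ B) ×ˢ B) := (hB.inter_left hC).prod hB
  have hxB : x ∈ B := Metric.mem_closedBall_self zero_le_one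
  have hex : ∀ k, ∃ w ∈ (C ∩ B) ×ˢ B, ∀ w' ∈ (C ∩ B) ×ˢ B, Φ k w ≤ Φ k w' := fun k =>
    hcomp.exists_isMinOn ⟨(x, x), ⟨hxC, hxB⟩, hxB⟩ (hΦc k).continuousOn
  choose w hwmem hwmin using hex
  obtain ⟨⟨z, u⟩, hzu, σ, hσ, hlim⟩ := hcomp.tendsto_subseq hwmem
  have hz1 : Tendsto (fun i => (w (σ i)).1) atTop (𝓝 z) := (continuous_fst.tendsto _).comp hlim
  have hu1 : Tendsto (fun i => (w (σ i)).2) atTop (𝓝 u) := (continuous_snd.tendsto _).comp hlim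
  have hσ' : Tendsto (fun i => (σ i : ℝ)) atTop atTop :=
    tendsto_natCast_atTop_atTop.comp hσ.tendsto_atTop
  have hle : ∀ k, Φ k (w k) ≤ f x + g x := by
    intro k
    simpa [Φ] using hwmin k (x, x) ⟨⟨hxC, hxB⟩, hxB⟩
  -- the penalties vanish in the limit
  have hpen : ‖z - u‖ ^ 2 + ‖p (z - x)‖ ^ 2 ≤ 0 := by
    have h1 : Tendsto (fun i => ‖(w (σ i)).1 - (w (σ i)).2‖ ^ 2 + ‖p ((w (σ i)).1 - x)‖ ^ 2)
        atTop (𝓝 (‖z - u‖ ^ 2 + ‖p (z - x)‖ ^ 2)) := by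
      have : Continuous fun w : E × E => ‖w.1 - w.2‖ ^ 2 + ‖p (w.1 - x)‖ ^ 2 := by fun_prop
      exact (this.tendsto (z, u)).comp hlim
    have h2 : Tendsto (fun i => (f x + g x - f (w (σ i)).1 - g (w (σ i)).2) * (2 * (σ i : ℝ)⁻¹))
        atTop (𝓝 ((f x + g x - f z - g u) * (2 * 0))) :=
      ((tendsto_const_nhds.sub ((hfc.tendsto z).comp hz1)).sub
        ((hgc.tendsto u).comp hu1)).mul ((tendsto_inv_atTop_zero.comp hσ').const_mul 2)
    rw [mul_zero, mul_zero] at h2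
    refine le_of_tendsto_of_tendsto h1 h2 ?_
    filter_upwards [hσ'.eventually_gt_atTop 0] with i hi
    have h3 := hle (σ i)
    have h4 : 0 ≤ ‖(w (σ i)).1 - x‖ ^ 2 := by positivity
    rw [← mul_assoc, ← div_eq_mul_inv, le_div_iff₀ hi]
    simp only [Φ] at h3
    linarith
  have hzu0 : z = u := by
    have : ‖z - u‖ ^ 2 ≤ 0 := by nlinarith [sq_nonneg ‖p (z - x)‖]
    exact sub_eq_zero.1 (norm_eq_zero.1 (pow_eq_zero_iff two_ne_zero |>.1
      (le_antisymm this (sq_nonneg _))))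
  have hzK : z ∈ K := by
    have : ‖p (z - x)‖ ^ 2 ≤ 0 := by nlinarith [sq_nonneg ‖z - u‖]
    have h1 := hp0 _ (norm_eq_zero.1 (pow_eq_zero_iff two_ne_zero |>.1
      (le_antisymm this (sq_nonneg _))))
    simpa using K.add_mem h1 hxK
  have hzx : z = x := by
    have h1 : f z + g u + 1 / 2 * ‖z - x‖ ^ 2 ≤ f x + g x := by
      have hc : Continuous fun w : E × E => f w.1 + g w.2 + 1 / 2 * ‖w.1 - x‖ ^ 2 := by fun_prop
      refine le_of_tendsto ((hc.tendsto (z, u)).comp hlim) (Eventually.of_forall fun i => ?_)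
      have h3 := hle (σ i)
      have h4 : 0 ≤ (σ i : ℝ) / 2 * ‖(w (σ i)).1 - (w (σ i)).2‖ ^ 2 := by positivity
      have h5 : 0 ≤ (σ i : ℝ) / 2 * ‖p ((w (σ i)).1 - x)‖ ^ 2 := by positivity
      simp only [Φ] at h3
      simp only [Function.comp]
      linarith
    have h2 := hmin z ⟨hzu.1.1, hzK⟩
    rw [← hzu0] at h1
    have h3 : ‖z - x‖ ^ 2 ≤ 0 := by linarith
    exact sub_eq_zero.1 (norm_eq_zero.1 (pow_eq_zero_iff two_ne_zero |>.1
      (le_antisymm h3 (sq_nonneg _))))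
  subst hzu0
  subst hzx
  -- first-order conditions at the approximate solutions
  let v : ℕ → E := fun i => (σ i : ℝ) • ((w (σ i)).1 - (w (σ i)).2)
  let ω : ℕ → E := fun i => (σ i : ℝ) • p ((w (σ i)).1 - z)
  -- Minus the gradient of `Φ` in its first variable.
  let n : ℕ → E := fun i => -(gradient f (w (σ i)).1 + v i + ω i + ((w (σ i)).1 - z))
  have hball : B ∈ 𝓝 z := Metric.closedBall_mem_nhds z one_pos
  have hzball : ∀ᶠ i in atTop, B ∈ 𝓝 (w (σ i)).1 :=
    hz1.eventually (eventually_mem_nhds_iff.2 hball)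
  have huball : ∀ᶠ i in atTop, B ∈ 𝓝 (w (σ i)).2 :=
    hu1.eventually (eventually_mem_nhds_iff.2 hball)
  have hv : ∀ᶠ i in atTop, v i ∈ subdifferential g (w (σ i)).2 := by
    filter_upwards [huball] with i hi
    refine smul_sub_mem_subdifferential hg ?_
    filter_upwards [hi] with y hy
    have := hwmin (σ i) ((w (σ i)).1, y) ⟨(hwmem (σ i)).1, hy⟩
    simp only [Φ] at this
    linarith
  have hn : ∀ᶠ i in atTop, n i ∈ regularNormalCone C (w (σ i)).1 := by
    filter_upwards [hzball] with i hi
    refine neg_mem_regularNormalCone (h := fun y => Φ (σ i) (y, (w (σ i)).2)) ?_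
      (hwmem (σ i)).1.1 ?_
    · have h1 : HasFDerivAt f (fderiv ℝ f (w (σ i)).1) (w (σ i)).1 :=
        (hf.differentiable one_ne_zero _).hasFDerivAt
      have h2 := ((hasFDerivAt_id (𝕜 := ℝ) (w (σ i)).1).sub_const (w (σ i)).2).norm_sq
      have h3 := ((hasFDerivAt_id (𝕜 := ℝ) (w (σ i)).1).sub_const z).norm_sq
      have h4 := (p.hasFDerivAt.comp _
        ((hasFDerivAt_id (𝕜 := ℝ) (w (σ i)).1).sub_const z)).norm_sq
      rw [hasGradientAt_iff_hasFDerivAt]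
      refine ((((h1.add_const (g (w (σ i)).2)).add (h2.const_mul ((σ i : ℝ) / 2))).add
        (h4.const_mul ((σ i : ℝ) / 2))).add (h3.const_mul (1 / 2))).congr_fderiv ?_
      ext y
      simp [v, ω, hpinner]
      ring
    · filter_upwards [nhdsWithin_le_nhds hi, self_mem_nhdsWithin] with y hy hyC
      exact hwmin (σ i) (y, (w (σ i)).2) ⟨⟨hyC, hy⟩, (hwmem (σ i)).2⟩
  -- a limit of the multipliers
  obtain ⟨R, hR⟩ := (isCompact_closedBall z (1 + 1)).exists_bound_of_continuousOn
    hgc.continuousOn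
  have hvbd : ∀ᶠ i in atTop, v i ∈ Metric.closedBall (0 : E) (2 * R) := by
    filter_upwards [hv] with i hi
    rw [mem_closedBall_zero_iff]
    exact norm_le_of_mem_subdifferential hR (hwmem (σ i)).2 hi
  -- The `ω i` may be unbounded, unlike the `v i`. Rescaling gives `t i + ‖t i • ω i‖ = 1`, so the
  -- limits `t₀` and `ω₀` cannot both vanish.
  let t : ℕ → ℝ := fun i => (1 + ‖ω i‖)⁻¹
  have htpos : ∀ i, 0 < t i := fun i => by positivity
  have ht1 : ∀ i, t i + ‖t i • ω i‖ = 1 := by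
    intro i
    rw [norm_smul, Real.norm_of_nonneg (htpos i).le]
    have : 1 + ‖ω i‖ ≠ 0 := by positivity
    simp only [t]
    field_simp
  have hcomp2 : IsCompact (Metric.closedBall (0 : E) (2 * R) ×ˢ Set.Icc (0 : ℝ) 1 ×ˢ
      Metric.closedBall (0 : E) 1) :=
    (isCompact_closedBall _ _).prod (isCompact_Icc.prod (isCompact_closedBall _ _))
  have hfreq : ∃ᶠ i in atTop, (v i, t i, t i • ω i) ∈ Metric.closedBall (0 : E) (2 * R) ×ˢ
      Set.Icc (0 : ℝ) 1 ×ˢ Metric.closedBall (0 : E) 1 := by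
    refine Eventually.frequently ?_
    filter_upwards [hvbd] with i hi
    refine ⟨hi, ⟨(htpos i).le, ?_⟩, ?_⟩
    · linarith [ht1 i, norm_nonneg (t i • ω i)]
    · rw [mem_closedBall_zero_iff]
      linarith [ht1 i, htpos i]
  obtain ⟨⟨v₀, t₀, ω₀⟩, hmem₀, τ, hτ, hlim₂⟩ := hcomp2.tendsto_subseq' hfreq
  have hτt := hτ.tendsto_atTop
  have hvl : Tendsto (fun i => v (τ i)) atTop (𝓝 v₀) := (continuous_fst.tendsto _).comp hlim₂
  have htl : Tendsto (fun i => t (τ i)) atTop (𝓝 t₀) :=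
    ((continuous_fst.comp continuous_snd).tendsto _).comp hlim₂
  have hωl : Tendsto (fun i => t (τ i) • ω (τ i)) atTop (𝓝 ω₀) :=
    ((continuous_snd.comp continuous_snd).tendsto _).comp hlim₂
  have hsum : t₀ + ‖ω₀‖ = 1 :=
    tendsto_nhds_unique (htl.add hωl.norm) (by simp only [ht1]; exact tendsto_const_nhds)
  have hω₀ : ω₀ ∈ Kᗮ := by
    refine (Submodule.isClosed_orthogonal K).mem_of_tendsto hωl (Eventually.of_forall fun i => ?_)
    exact Kᗮ.smul_mem _ (Kᗮ.smul_mem _ (hpK _))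
  have hv₀ : v₀ ∈ subdifferential g z :=
    mem_subdifferential_of_tendsto hgc (hu1.comp hτt) hvl (hτt.eventually hv)
  have hgrad : Continuous (gradient f) := by
    unfold gradient
    exact (LinearIsometryEquiv.continuous _).comp (hf.continuous_fderiv one_ne_zero)
  have hnl : Tendsto (fun i => t (τ i) • n (τ i)) atTop
      (𝓝 (-(t₀ • gradient f z + t₀ • v₀ + ω₀))) := by
    have h1 := hz1.comp hτt
    have h2 := ((((htl.smul ((hgrad.tendsto z).comp h1)).add (htl.smul hvl)).add hωl).add
      (htl.smul (h1.sub_const z))).neg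
    rw [sub_self, smul_zero, add_zero] at h2
    refine h2.congr fun i => ?_
    simp only [n, Function.comp]
    module
  have hN : -(t₀ • gradient f z + t₀ • v₀ + ω₀) ∈ normalCone C z := by
    obtain ⟨N, hN⟩ := eventually_atTop.1 (hτt.eventually hn)
    refine ⟨hxC, fun i => (w (σ (τ (i + N)))).1, fun i => t (τ (i + N)) • n (τ (i + N)),
      fun i => smul_mem_regularNormalCone (htpos _) (hN _ (by omega)), ?_, ?_⟩
    · exact (tendsto_add_atTop_iff_nat N).2 (hz1.comp hτt)
    · exact (tendsto_add_atTop_iff_nat N).2 hnl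
  -- If `t₀ = 0`, then `-ω₀` is a normal in `Kᗮ`, hence zero by the qualification, against `t₀ +
  -- ‖ω₀‖ = 1`. With `t₀ > 0` one can divide by it.
  have ht₀ : 0 < t₀ := by
    refine lt_of_le_of_ne hmem₀.2.1.1 fun h0 => ?_
    rw [← h0] at hN hsum
    have h1 := hq _ hN (by simpa using hω₀)
    have h2 : ω₀ = 0 := by simpa using h1
    simp [h2] at hsum
  refine ⟨v₀, hv₀, _, smul_mem_normalCone (inv_pos.2 ht₀) hN, ?_⟩
  have : gradient f z + v₀ + t₀⁻¹ • -(t₀ • gradient f z + t₀ • v₀ + ω₀) = -(t₀⁻¹ • ω₀) := by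
    rw [smul_neg, smul_add, smul_add, inv_smul_smul₀ ht₀.ne', inv_smul_smul₀ ht₀.ne']
    abel
  rw [this]
  exact Kᗮ.neg_mem (Kᗮ.smul_mem _ hω₀)

end Calculus

/-! ### Gluing normals and subgradients blockwise -/

section Product

variable {E : Type*} [NormedAddCommGroup E] [InnerProductSpace ℝ E] {ι : Type*} [Fintype ι]
  {π : ι → E →L[ℝ] E}

/-- The regular normal cone of a product set contains the product of the regular normal cones
of its factors. -/
theorem sum_mem_regularNormalCone {C : Set E}
    (hsymm : ∀ q x z, inner ℝ (π q x) z = inner ℝ x (π q z))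
    (hcomb : ∀ Z : ι → E, (∀ q, Z q ∈ C) → ∑ q, π q (Z q) ∈ C)
    (hmix : ∀ q, ∀ x ∈ C, ∀ z ∈ C, x + π q (z - x) ∈ C)
    (hproj : ∀ q (Z : ι → E), π q (∑ r, π r (Z r)) = π q (Z q))
    {xs vs : ι → E} (h : ∀ q, vs q ∈ regularNormalCone C (xs q)) :
    ∑ q, π q (vs q) ∈ regularNormalCone C (∑ q, π q (xs q)) := by
  refine ⟨hcomb xs fun q => (h q).1, fun ε hε => ?_⟩
  set x := ∑ q, π q (xs q) with hx
  have hπx : ∀ q, π q x = π q (xs q) := fun q => hproj q xs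
  -- Changing only block `q` of `xs q` stays in `C`, so each normal can be tested on its own block.
  have hlim : ∀ q, Tendsto (fun z => xs q + π q (z - xs q)) (𝓝[C] x) (𝓝[C] (xs q)) := by
    intro q
    refine tendsto_nhdsWithin_iff.2 ⟨?_, ?_⟩
    · have hc : Continuous fun z => xs q + π q (z - xs q) := by fun_prop
      have h1 := (hc.tendsto x).mono_left (nhdsWithin_le_nhds (s := C))
      rwa [map_sub, hπx, sub_self, add_zero] at h1
    · filter_upwards [self_mem_nhdsWithin] with z hz using hmix q _ (h q).1 z hz
  have hev : ∀ᶠ z in 𝓝[C] x, ∀ q, inner ℝ (vs q) (xs q + π q (z - xs q) - xs q)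
      ≤ ε / (1 + ∑ q, ‖π q‖) * ‖xs q + π q (z - xs q) - xs q‖ :=
    eventually_all.2 fun q => (hlim q).eventually ((h q).2 _ (by positivity))
  filter_upwards [hev] with z hz
  have hdiff : ∀ q, xs q + π q (z - xs q) - xs q = π q (z - x) := by
    intro q
    rw [add_sub_cancel_left, map_sub, map_sub, hπx]
  simp only [hdiff] at hz
  rw [sum_inner]
  calc ∑ q, inner ℝ (π q (vs q)) (z - x)
      ≤ ∑ q, ε / (1 + ∑ q, ‖π q‖) * (‖π q‖ * ‖z - x‖) := by
        refine Finset.sum_le_sum fun q _ => ?_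
        rw [hsymm]
        refine (hz q).trans ?_
        gcongr
        exact (π q).le_opNorm _
    _ = ε / (1 + ∑ q, ‖π q‖) * ((∑ q, ‖π q‖) * ‖z - x‖) := by
        rw [← Finset.mul_sum, ← Finset.sum_mul]
    _ ≤ ε / (1 + ∑ q, ‖π q‖) * ((1 + ∑ q, ‖π q‖) * ‖z - x‖) := by
        gcongr
        linarith
    _ = ε * ‖z - x‖ := by field_simp

/-- The normal cone of a product set contains the product of the normal cones of its factors. -/
theorem sum_mem_normalCone {C : Set E}
    (hsymm : ∀ q x z, inner ℝ (π q x) z = inner ℝ x (π q z))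
    (hcomb : ∀ Z : ι → E, (∀ q, Z q ∈ C) → ∑ q, π q (Z q) ∈ C)
    (hmix : ∀ q, ∀ x ∈ C, ∀ z ∈ C, x + π q (z - x) ∈ C)
    (hproj : ∀ q (Z : ι → E), π q (∑ r, π r (Z r)) = π q (Z q))
    {x : E} (hx : ∑ q, π q x = x) {vs : ι → E} (h : ∀ q, vs q ∈ normalCone C x) :
    ∑ q, π q (vs q) ∈ normalCone C x := by
  choose hxC ys us hreg hys hus using h
  -- The approximating base points depend on `q`; gluing their blocks gives a common one.
  refine ⟨hx ▸ hcomb (fun _ => x) hxC, fun i => ∑ q, π q (ys q i), fun i => ∑ q, π q (us q i),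
    fun i => sum_mem_regularNormalCone hsymm hcomb hmix hproj fun q => hreg q i, ?_, ?_⟩
  · have h1 := tendsto_finsetSum Finset.univ fun q _ => ((π q).continuous.tendsto x).comp (hys q)
    rwa [hx] at h1
  · exact tendsto_finsetSum _ fun q _ => ((π q).continuous.tendsto _).comp (hus q)

/-- The subdifferential of a separable function contains the product of the subdifferentials of
its terms. -/
theorem sum_mem_subdifferential {g : E → ℝ}
    (hsymm : ∀ q x z, inner ℝ (π q x) z = inner ℝ x (π q z)) {x : E}
    (hg : ∀ z, g z - g x = ∑ q, (g (x + π q (z - x)) - g x)) {vs : ι → E}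
    (h : ∀ q, vs q ∈ subdifferential g x) : ∑ q, π q (vs q) ∈ subdifferential g x := by
  intro z
  have h1 : ∑ q, inner ℝ (π q (vs q)) (z - x) ≤ g z - g x := by
    rw [hg]
    refine Finset.sum_le_sum fun q _ => ?_
    have := h q (x + π q (z - x))
    rw [add_sub_cancel_left] at this
    rw [hsymm]
    linarith
  rw [sum_inner]
  linarith

end Product

end NSDASF

namespace NSDASF.Problem

/-! ### Block structure of the filtering problem -/

variable {ι : Type*} [Fintype ι] [DecidableEq ι] {H : Type*} (P : Problem ι H)

theorem inner_eq_sum {m n : Type*} [Fintype m] [Fintype n] (A B : Matrix m n ℝ) :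
    inner ℝ A B = ∑ i, ∑ j, A i j * B i j := by
  change Matrix.trace (Aᵀ * B) = _
  simp only [Matrix.trace, Matrix.diag_apply, Matrix.mul_apply, Matrix.transpose_apply]
  exact Finset.sum_comm

/-- The projection that keeps the block of node `q` and annihilates the other blocks. -/
noncomputable def blockProj (q : ι) : Matrix P.Chan (Fin P.Q) ℝ →L[ℝ] Matrix P.Chan (Fin P.Q) ℝ :=
  LinearMap.toContinuousLinearMap
    { toFun := fun X => Matrix.of fun c j => if c.1 = q then X c j else 0
      map_add' := fun X Y => by
        ext c j
        by_cases h : c.1 = q <;> simp [h]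
      map_smul' := fun r X => by
        ext c j
        by_cases h : c.1 = q <;> simp [h] }

theorem blockProj_apply (q : ι) (X : Matrix P.Chan (Fin P.Q) ℝ) (c : P.Chan) (j : Fin P.Q) :
    P.blockProj q X c j = if c.1 = q then X c j else 0 := rfl

theorem sum_blockProj_apply (Z : ι → Matrix P.Chan (Fin P.Q) ℝ) (c : P.Chan) (j : Fin P.Q) :
    (∑ q, P.blockProj q (Z q)) c j = Z c.1 c j := by
  simp [Matrix.sum_apply, blockProj_apply]

theorem sum_blockProj (X : Matrix P.Chan (Fin P.Q) ℝ) : ∑ q, P.blockProj q X = X := by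
  ext c j
  exact P.sum_blockProj_apply (fun _ => X) c j

theorem blockProj_sum (q : ι) (Z : ι → Matrix P.Chan (Fin P.Q) ℝ) :
    P.blockProj q (∑ r, P.blockProj r (Z r)) = P.blockProj q (Z q) := by
  ext c j
  rw [blockProj_apply, blockProj_apply, sum_blockProj_apply]
  split_ifs with h
  · rw [h]
  · rfl

theorem inner_blockProj (q : ι) (X Y : Matrix P.Chan (Fin P.Q) ℝ) :
    inner ℝ (P.blockProj q X) Y = inner ℝ X (P.blockProj q Y) := by
  simp only [inner_eq_sum, blockProj_apply, ite_mul, mul_ite, zero_mul, mul_zero]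

theorem block_sum_blockProj (Z : ι → Matrix P.Chan (Fin P.Q) ℝ) (k : ι) :
    P.block (∑ q, P.blockProj q (Z q)) k = P.block (Z k) k := by
  ext m j
  exact P.sum_blockProj_apply Z ⟨k, m⟩ j

theorem block_add_blockProj_sub (q k : ι) (X Z : Matrix P.Chan (Fin P.Q) ℝ) :
    P.block (X + P.blockProj q (Z - X)) k = if k = q then P.block Z k else P.block X k := by
  ext m j
  change X ⟨k, m⟩ j + P.blockProj q (Z - X) ⟨k, m⟩ j = _
  rw [blockProj_apply]
  split_ifs with h
  · simp [block]
  · simp [block]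

section Constraints

variable [AddCommGroup H] [Module ℝ H]

theorem sum_blockProj_mem_feasibleSet {Z : ι → Matrix P.Chan (Fin P.Q) ℝ}
    (hZ : ∀ q, Z q ∈ P.feasibleSet) : ∑ q, P.blockProj q (Z q) ∈ P.feasibleSet := by
  intro k
  rw [block_sum_blockProj]
  exact hZ k k

theorem add_blockProj_sub_mem_feasibleSet (q : ι) {X Z : Matrix P.Chan (Fin P.Q) ℝ}
    (hX : X ∈ P.feasibleSet) (hZ : Z ∈ P.feasibleSet) :
    X + P.blockProj q (Z - X) ∈ P.feasibleSet := by
  intro k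
  rw [block_add_blockProj_sub]
  split_ifs
  · exact hZ k
  · exact hX k

variable {P}

theorem Standing.isClosed_feasibleSet (hP : P.Standing) : IsClosed P.feasibleSet := by
  have hb : ∀ k, Continuous fun X : Matrix P.Chan (Fin P.Q) ℝ => P.block X k := fun k =>
    continuous_matrix fun m j => continuous_id.matrix_elem _ _
  have hc : ∀ k, ∀ j ∈ P.JI k ∪ P.JE k, Continuous fun X => P.constr k j (P.block X k) :=
    fun k j hj => (hP.smooth_η k j hj).continuous.comp (hb k)
  simp only [feasibleSet, Set.ofPred_forall, Set.ofPred_and]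
  refine isClosed_iInter fun k => IsClosed.inter ?_ ?_
  · exact isClosed_iInter fun j => isClosed_iInter fun hj =>
      isClosed_le (hc k j (Or.inl hj)) continuous_const
  · exact isClosed_iInter fun j => isClosed_iInter fun hj =>
      isClosed_eq (hc k j (Or.inr hj)) continuous_const

theorem Standing.convexOn_g (hP : P.Standing) : ConvexOn ℝ Set.univ P.g := by
  refine ⟨convex_univ, fun X _ Y _ a b ha hb hab => ?_⟩
  have := hP.convex_γ.2 (Set.mem_univ (Xᵀ * Matrix.blockDiagonal' P.A))
    (Set.mem_univ (Yᵀ * Matrix.blockDiagonal' P.A)) ha hb hab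
  simpa [g, Matrix.add_mul] using this

/-- Replacing block `q` alone affects only the `q`-th term of the separable `g`. -/
theorem Standing.g_sub_g (hP : P.Standing) (X Z : Matrix P.Chan (Fin P.Q) ℝ) :
    P.g Z - P.g X = ∑ q, (P.g (X + P.blockProj q (Z - X)) - P.g X) := by
  obtain ⟨γ', hγ'⟩ := hP.separable_γ
  have hg : ∀ Y, P.g Y = ∑ k, γ' k ((P.block Y k)ᵀ * P.A k) := hγ'
  simp only [hg, block_add_blockProj_sub, ← Finset.sum_sub_distrib]
  refine Finset.sum_congr rfl fun q _ => ?_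
  rw [Finset.sum_eq_single q (fun k _ hk => by rw [if_neg hk, sub_self]) (by simp), if_pos rfl]

end Constraints

open Classical in
/-- `localRange` as a subspace. -/
def localSubspace (T : SimpleGraph ι) (q : ι) (X : Matrix P.Chan (Fin P.Q) ℝ) :
    Submodule ℝ (Matrix P.Chan (Fin P.Q) ℝ) where
  carrier := P.localRange T q X
  add_mem' := by
    rintro _ _ ⟨W, rfl⟩ ⟨W', rfl⟩
    exact ⟨W + W', (Matrix.mul_add _ _ _).symm⟩
  zero_mem' := ⟨0, (Matrix.mul_zero _).symm⟩
  smul_mem' := by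
    rintro r _ ⟨W, rfl⟩
    exact ⟨r • W, (Matrix.mul_smul _ _ _).symm⟩

/-- With `S = C_q T_qᵀ`, testing orthogonality against `S Sᵀ U` gives `‖Sᵀ U‖² = 0`. -/
theorem fusion_mul_eq_zero_of_mem_orthogonal {T : SimpleGraph ι} {q : ι}
    {X U : Matrix P.Chan (Fin P.Q) ℝ} (hU : U ∈ (P.localSubspace T q X)ᗮ) :
    P.fusion T q * (P.C q X)ᵀ * U = 0 := by
  classical
  set S := P.C q X * (P.fusion T q)ᵀ with hS
  have hST : P.fusion T q * (P.C q X)ᵀ = Sᵀ := by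
    rw [hS, Matrix.transpose_mul, Matrix.transpose_transpose]
  have h := (Submodule.mem_orthogonal _ _).1 hU (S * (Sᵀ * U)) ⟨Sᵀ * U, by rw [hS]⟩
  rw [hST]
  have h2 : inner ℝ (S * (Sᵀ * U)) U = inner ℝ (Sᵀ * U) (Sᵀ * U) := by
    change Matrix.trace ((S * (Sᵀ * U))ᵀ * U) = Matrix.trace ((Sᵀ * U)ᵀ * (Sᵀ * U))
    rw [Matrix.transpose_mul, Matrix.mul_assoc]
  rw [h2] at h
  exact inner_self_eq_zero.1 h

/-- The updating node sees its own channels uncompressed. This turns orthogonality to the local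
subspace into an exact equation on block `q`. -/
theorem fusion_mul_apply_inl (T : SimpleGraph ι) (q : ι) (X U : Matrix P.Chan (Fin P.Q) ℝ)
    (m : Fin (P.M q)) (j : Fin P.Q) :
    (P.fusion T q * (P.C q X)ᵀ * U) (.inl m) j = U ⟨q, m⟩ j := by
  rw [Matrix.mul_assoc, Matrix.mul_apply, Fintype.sum_sum_type]
  simp [fusion, Matrix.one_apply, Matrix.mul_apply, C]

end NSDASF.Problem

/-! ### Stationarity of fixed points -/

theorem proposition4 {ι : Type*} [Fintype ι] [DecidableEq ι]
    {H : Type*} [AddCommGroup H] [Module ℝ H]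
    (P : NSDASF.Problem ι H) (hP : P.Standing)
    (G : SimpleGraph ι) (T : ι → SimpleGraph ι)
    (hT : ∀ k, (T k).IsTree ∧ T k ≤ G)
    (X : Matrix P.Chan (Fin P.Q) ℝ) (hfix : P.IsFixedPoint T X)
    (hqual : ∀ k, ∀ U ∈ NSDASF.normalCone P.feasibleSet X,
      P.fusion (T k) k * (P.C k X)ᵀ * U = 0 → U = 0) :
    P.IsStationary X := by
  have hloc : ∀ k, ∃ v ∈ NSDASF.subdifferential P.g X,
      ∃ n ∈ NSDASF.normalCone P.feasibleSet X,
        gradient P.f X + v + n ∈ (P.localSubspace (T k) k X)ᗮ := fun k =>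
    NSDASF.exists_add_mem_orthogonal_of_mem_argmin hP.smooth_φ hP.convexOn_g
      hP.isClosed_feasibleSet _ (hfix k) fun n hn hnK =>
        hqual k n hn (P.fusion_mul_eq_zero_of_mem_orthogonal hnK)
  choose v hv n hn hK using hloc
  have hvX := NSDASF.sum_mem_subdifferential P.inner_blockProj (hP.g_sub_g X) hv
  have hnX := NSDASF.sum_mem_normalCone P.inner_blockProj
    (fun _ hZ => P.sum_blockProj_mem_feasibleSet hZ)
    (fun q _ hx _ hz => P.add_blockProj_sub_mem_feasibleSet q hx hz)
    P.blockProj_sum (P.sum_blockProj X) hn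
  refine Set.mem_add.2 ⟨_, Set.add_mem_add (Set.mem_singleton _) hvX, _, hnX, ?_⟩
  ext ⟨q, m⟩ j
  -- A row belonging to node `q` is checked with the multipliers of that same node.
  have h0 := P.fusion_mul_apply_inl (T q) q X (gradient P.f X + v q + n q) m j
  rw [P.fusion_mul_eq_zero_of_mem_orthogonal (hK q)] at h0
  have h1 := P.sum_blockProj_apply v ⟨q, m⟩ j
  have h2 := P.sum_blockProj_apply n ⟨q, m⟩ j
  refine (congrArg₂ (gradient P.f X ⟨q, m⟩ j + · + ·) h1 h2).trans h0.symm
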